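/- All alphabets are finite. A family of languages $\mathscr{F}$ is \emph{closed under rational transduction} if, whenever $L \subseteq A^*$ belongs to $\mathscr{F}$ and $R \subseteq A^* \times B^*$ is a rational relation (one realised by a finite transducer), the language $\{v \in B^* \mid (u,v) \in R \text{ for some } u \in L\}$ belongs to $\mathscr{F}$. Let $S$ be a semigroup and $\sigma : X^+ \to S$ a finite choice of generators, that is, a surjective morphism from the free semigroup on a finite set $X$. Let $S^1$ be the monoid obtained from $S$ by adjoining a new identity $1$ (even if $S$ already has one), let $\overline{X} = \{\overline{x} \mid x \in X\}$ be a disjoint copy of $X$, and let $\hat{X} = X \cup \overline{X}$. The \emph{loop problem} $L_\sigma(S) \subseteq \hat{X}^*$ is the set of labels of paths from $1$ to $1$ in the directed graph with vertex set $S^1$ having, for all $a \in S^1$ and $x \in X$, an edge labelled $x$ from $a$ to $a(x\sigma)$ and an edge labelled $\overline{x}$ from $a(x\sigma)$ to $a$. We say that $S$ \emph{has loop problem in} $\mathscr{F}$ if $S$ is finitely generated and $L_\sigma(S) \in \mathscr{F}$ for some finite choice of generators $\sigma$ (equivalently for every one, when $\mathscr{F}$ is closed under rational transduction). A semigroup $S$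 with zero is \emph{completely zero-simple} if $S^2 \neq \{0\}$, the only ideals of $S$ are $\{0\}$ and $S$, and $S$ has a primitive idempotent, that is, an idempotent $e \neq 0$ such that every idempotent $f \neq 0$ with $ef = fe = f$ equals $e$. A \emph{maximal subgroup} of $S$ is a subsemigroup which is a group and is maximal under inclusion among such subsemigroups; it is \emph{non-zero} if it is not $\{0\}$. \textbf{Theorem.} Let $\mathscr{F}$ be a family of languages closed under union, rational transduction, product and Kleene closure, and let $S$ be a finitely generated completely zero-simple semigroup. Then the following are equivalent: (i) $S$ has loop problem in $\mathscr{F}$; (ii) some non-zero maximal subgroup of $S$ (regarded as a semigroup) has loop problem in $\mathscr{F}$; (iii) every non-zero maximal subgroup of $S$ (regarded as a semigroup) has loop problem in $\mathscr{F}$. -/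

import Mathlib

/-! ### Loop automata and loop problems -/

/-- The (right) loop automaton of a monoid `M` with respect to `σ : X* → M`. The alphabet is
`X ⊕ X`: the letter `inl x` stands for the generator `x`, the letter `inr x` for its formal
inverse. There is an edge `a → b` labelled `inl x` iff `a * σ x = b`, and an edge `a → b`
labelled `inr x` iff `b * σ x = a`. The state set is `M` and is usually infinite. -/
def loopAutomaton {X M : Type*} [Monoid M] (σ : FreeMonoid X →* M) : NFA (X ⊕ X) M where
  step a s := match s with
    | Sum.inl x => {b | a * σ (FreeMonoid.of x) = b}
    | Sum.inr x => {b | b * σ (FreeMonoid.of x) = a}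
  start := {1}
  accept := {1}

/-- The (right) loop problem of a monoid with respect to `σ`. -/
def monoidLoopProblem {X M : Type*} [Monoid M] (σ : FreeMonoid X →* M) : Language (X ⊕ X) :=
  (loopAutomaton σ).accepts

/-- The extension `X* → S¹` of a morphism `X⁺ → S`. The monoid `S¹ = WithOne S` always has a new
identity, even if `S` already has one. -/
def extendOne {X S : Type*} [Semigroup S] (σ : FreeSemigroup X →ₙ* S) :
    FreeMonoid X →* WithOne S :=
  FreeMonoid.lift fun x => ((σ (FreeSemigroup.of x) : S) : WithOne S)

/-- The loop problem of a semigroup `S` with respect to `σ : X⁺ → S`. -/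
def loopProblem {X S : Type*} [Semigroup S] (σ : FreeSemigroup X →ₙ* S) : Language (X ⊕ X) :=
  monoidLoopProblem (extendOne σ)

/-- `S` admits a finite choice of semigroup generators. -/
def IsFinGenSemigroup (S : Type*) [Semigroup S] : Prop :=
  ∃ (X : Type) (_ : Finite X) (σ : FreeSemigroup X →ₙ* S), Function.Surjective σ

/-! ### Families of languages and rational transductions -/

/-- A finite transducer from `A*` to `B*`: finitely many states and finitely many transitions,
each labelled by a pair of words. -/
structure FinTransducer (A B : Type) where
  State : Type
  finite_state : Finite State
  trans : Set (State × List A × List B × State)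
  finite_trans : trans.Finite
  start : Set State
  accept : Set State

/-- `T.Path p u v q`: there is a path from `p` to `q` labelled `(u, v)`. -/
inductive FinTransducer.Path {A B : Type} (T : FinTransducer A B) :
    T.State → List A → List B → T.State → Prop
  | nil (p : T.State) : Path T p [] [] p
  | cons {p q r : T.State} {u u' : List A} {v v' : List B} :
      (p, u, v, q) ∈ T.trans → Path T q u' v' r → Path T p (u ++ u') (v ++ v') r

/-- The relation between `A*` and `B*` realised by a transducer. -/
def FinTransducer.Rel {A B : Type} (T : FinTransducer A B) (u : List A) (v : List B) : Prop :=
  ∃ p ∈ T.start, ∃ q ∈ T.accept, T.Path p u v q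

/-- The image of a language under the rational transduction realised by `T`. -/
def FinTransducer.image {A B : Type} (T : FinTransducer A B) (L : Language A) : Language B :=
  {v | ∃ u ∈ L, T.Rel u v}

/-- A family of languages: for each alphabet, a set of languages over it. Only finite alphabets
matter below. -/
abbrev LanguageFamily : Type 1 := (A : Type) → Set (Language A)

namespace LanguageFamily

def ClosedUnderUnion (F : LanguageFamily) : Prop :=
  ∀ (A : Type) [Finite A] (L K : Language A), L ∈ F A → K ∈ F A → L + K ∈ F A

def ClosedUnderProduct (F : LanguageFamily) : Prop :=
  ∀ (A : Type) [Finite A] (L K : Language A), L ∈ F A → K ∈ F A → L * K ∈ F A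

def ClosedUnderKleene (F : LanguageFamily) : Prop :=
  ∀ (A : Type) [Finite A] (L : Language A), L ∈ F A → KStar.kstar L ∈ F A

def ClosedUnderTransduction (F : LanguageFamily) : Prop :=
  ∀ (A B : Type) [Finite A] [Finite B] (T : FinTransducer A B) (L : Language A),
    L ∈ F A → T.image L ∈ F B

end LanguageFamily

/-- `S` is finitely generated and has loop problem in `F`, with respect to some finite choice of
generators (equivalently every one, see `HasLoopProblemIn.loopProblem_mem`). -/
def HasLoopProblemIn (F : LanguageFamily) (S : Type*) [Semigroup S] : Prop :=
  ∃ (X : Type) (_ : Finite X) (σ : FreeSemigroup X →ₙ* S),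
    Function.Surjective σ ∧ loopProblem σ ∈ F (X ⊕ X)

/-! ### Completely zero-simple semigroups and maximal subgroups -/

section Semigroups

variable {S : Type*}

/-- A non-empty two-sided ideal. -/
def IsIdealOf [Semigroup S] (I : Set S) : Prop :=
  I.Nonempty ∧ ∀ a ∈ I, ∀ s : S, s * a ∈ I ∧ a * s ∈ I

/-- `S` is zero-simple: `S² ≠ {0}`, and `{0}` and `S` are the only ideals. -/
def IsZeroSimple (S : Type*) [SemigroupWithZero S] : Prop :=
  (∃ a b : S, a * b ≠ 0) ∧ ∀ I : Set S, IsIdealOf I → I = {0} ∨ I = Set.univ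

/-- `e` is a primitive idempotent: minimal among the non-zero idempotents for the order
`f ≤ e ↔ e * f = f ∧ f * e = f`. -/
def IsPrimitiveIdempotent [SemigroupWithZero S] (e : S) : Prop :=
  e ≠ 0 ∧ IsIdempotentElem e ∧
    ∀ f : S, f ≠ 0 → IsIdempotentElem f → e * f = f → f * e = f → f = e

/-- `S` is completely zero-simple: zero-simple with a primitive idempotent. -/
def IsCompletelyZeroSimple (S : Type*) [SemigroupWithZero S] : Prop :=
  IsZeroSimple S ∧ ∃ e : S, IsPrimitiveIdempotent e

/-- The subsemigroup `T` is a group under the multiplication of `S` (its identity need not be an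
identity of `S`). -/
def Subsemigroup.IsGroup [Semigroup S] (T : Subsemigroup S) : Prop :=
  ∃ e ∈ T, (∀ x ∈ T, e * x = x ∧ x * e = x) ∧ ∀ x ∈ T, ∃ y ∈ T, x * y = e ∧ y * x = e

/-- `T` is a maximal subgroup of `S` other than `{0}`. -/
def Subsemigroup.IsNonzeroMaximalSubgroup [SemigroupWithZero S] (T : Subsemigroup S) : Prop :=
  Maximal Subsemigroup.IsGroup T ∧ (T : Set S) ≠ {0}

end Semigroups

/-! ### Independence of the choice of generators -/

section Independence

variable {X Y S : Type*} [Semigroup S]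

/-- The letter `y` is replaced by the word `w y`, its formal inverse by the formal inverse of
`w y`. -/
def hatSubst (w : Y → List X) : Y ⊕ Y → List (X ⊕ X)
  | Sum.inl y => (w y).map Sum.inl
  | Sum.inr y => ((w y).map Sum.inr).reverse

theorem loopAutomaton_evalFrom_pos {M : Type*} [Monoid M] (σ : FreeMonoid X →* M)
    (u : List X) (A : Set M) :
    (loopAutomaton σ).evalFrom A (u.map Sum.inl) =
      {b | ∃ a ∈ A, a * σ (FreeMonoid.ofList u) = b} := by
  induction u generalizing A with
  | nil => ext b; simp
  | cons x u ih =>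
    rw [List.map_cons, NFA.evalFrom_cons, ih]
    ext b
    simp [NFA.mem_stepSet, loopAutomaton, FreeMonoid.ofList_cons, mul_assoc]

theorem loopAutomaton_evalFrom_neg {M : Type*} [Monoid M] (σ : FreeMonoid X →* M)
    (u : List X) (A : Set M) :
    (loopAutomaton σ).evalFrom A ((u.map Sum.inr).reverse) =
      {b | ∃ a ∈ A, b * σ (FreeMonoid.ofList u) = a} := by
  induction u generalizing A with
  | nil => ext b; simp
  | cons x u ih =>
    rw [List.map_cons, List.reverse_cons, NFA.evalFrom_append, ih]
    ext b
    simp [NFA.mem_stepSet, loopAutomaton, FreeMonoid.ofList_cons, mul_assoc]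

theorem loopAutomaton_evalFrom_hatSubst {M : Type*} [Monoid M] (σ : FreeMonoid X →* M)
    (τ : FreeMonoid Y →* M) (w : Y → List X)
    (hw : ∀ y, σ (FreeMonoid.ofList (w y)) = τ (FreeMonoid.of y))
    (v : List (Y ⊕ Y)) (A : Set M) :
    (loopAutomaton σ).evalFrom A (v.flatMap (hatSubst w)) =
      (loopAutomaton τ).evalFrom A v := by
  induction v generalizing A with
  | nil => simp
  | cons s v ih =>
    rw [List.flatMap_cons, NFA.evalFrom_append, NFA.evalFrom_cons, ih]
    congr 1
    cases s with
    | inl y =>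
      rw [hatSubst, loopAutomaton_evalFrom_pos]
      ext b
      simp [NFA.mem_stepSet, loopAutomaton, hw, eq_comm]
    | inr y =>
      rw [hatSubst, loopAutomaton_evalFrom_neg]
      ext b
      simp [NFA.mem_stepSet, loopAutomaton, hw]

/-- The one-state transducer realising the inverse of the free monoid morphism given by `f`. -/
def inverseMorphism {A B : Type} [Finite B] (f : B → List A) : FinTransducer A B where
  State := Unit
  finite_state := inferInstance
  trans := Set.range fun b => ((), f b, [b], ())
  finite_trans := Set.finite_range _
  start := Set.univ
  accept := Set.univ

theorem inverseMorphism_path {A B : Type} [Finite B] (f : B → List A)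
    (p q : (inverseMorphism f).State) (u : List A) (v : List B) :
    (inverseMorphism f).Path p u v q ↔ u = v.flatMap f := by
  constructor
  · intro h
    induction h with
    | nil => rfl
    | cons h _ ih =>
      obtain ⟨b, hb⟩ := h
      simp only at hb
      obtain ⟨-, rfl, rfl, -⟩ := hb
      simp [ih]
  · rintro rfl
    induction v generalizing p with
    | nil => exact FinTransducer.Path.nil _
    | cons b v ih =>
      exact FinTransducer.Path.cons (T := inverseMorphism f) (q := ()) (v := [b])
        ⟨b, rfl⟩ (ih ())

theorem exists_word (σ : FreeSemigroup X →ₙ* S) (hσ : Function.Surjective σ) (s : S) :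
    ∃ w : List X, extendOne σ (FreeMonoid.ofList w) = (s : WithOne S) := by
  obtain ⟨t, rfl⟩ := hσ s
  induction t using FreeSemigroup.recOnMul with
  | ih1 x => exact ⟨[x], by simp [extendOne]⟩
  | ih2 x t h1 h2 =>
    obtain ⟨w1, h1⟩ := h1
    obtain ⟨w2, h2⟩ := h2
    exact ⟨w1 ++ w2, by rw [FreeMonoid.ofList_append, map_mul, h1, h2, map_mul, WithOne.coe_mul]⟩

end Independence

/-- Having loop problem in a family closed under rational transductions does not depend on the
finite choice of generators. -/
theorem HasLoopProblemIn.loopProblem_mem {F : LanguageFamily} (hF : F.ClosedUnderTransduction)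
    {S : Type*} [Semigroup S] (h : HasLoopProblemIn F S) {Y : Type} [Finite Y]
    (τ : FreeSemigroup Y →ₙ* S) : loopProblem τ ∈ F (Y ⊕ Y) := by
  obtain ⟨X, hX, σ, hσ, hL⟩ := h
  choose w hw using fun y => exists_word σ hσ (τ (FreeSemigroup.of y))
  have key : (inverseMorphism (hatSubst w)).image (loopProblem σ) = loopProblem τ := by
    ext v
    have h1 : v ∈ (inverseMorphism (hatSubst w)).image (loopProblem σ) ↔
        v.flatMap (hatSubst w) ∈ loopProblem σ := by
      constructor
      · rintro ⟨u, hu, p, -, q, -, hp⟩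
        rw [inverseMorphism_path] at hp
        exact hp ▸ hu
      · intro hv
        exact ⟨_, hv, (), trivial, (), trivial, (inverseMorphism_path _ _ _ _ _).2 rfl⟩
    rw [h1]
    have h2 := loopAutomaton_evalFrom_hatSubst (extendOne σ) (extendOne τ) w
      (fun y => by rw [hw]; simp [extendOne]) v {1}
    unfold loopProblem monoidLoopProblem
    change (∃ s ∈ ({1} : Set (WithOne S)), s ∈ (loopAutomaton (extendOne σ)).evalFrom {1} _) ↔
      ∃ s ∈ ({1} : Set (WithOne S)), s ∈ (loopAutomaton (extendOne τ)).evalFrom {1} _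
    rw [h2]
  exact key ▸ hF _ _ _ _ hL

/-!
Cutting a loop at its visits to the adjoined identity shows that the loop problem of `S` is the
Kleene closure of a finite union of languages `x L y⁻¹`, where `L` consists of the labels of the
paths from `σ x` to `σ y` in the graph on `S` itself. Such a path either avoids `0` or passes
through it.

In a completely zero-simple semigroup every non-zero product `u * s` can be multiplied back to `s`
on the left. Left multiplication maps paths to paths and fixes `0`, so the labels of the paths from
`s` to `0` depend only on the last letter of a word representing `s`. There are thus finitely many
such languages, which makes them regular; the same holds for the paths starting at `0`.

Let `e ≠ 0` be an idempotent. The non-zero elements of `eSe` form a maximal subgroup `G`, and all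
non-zero maximal subgroups arise in this way. The paths avoiding `0` are left translates of paths
among the non-zero elements of `eS`, on which `G` acts freely by left multiplication with finitely
many orbits. A finite transducer that records the current orbit therefore turns the word problem of
`G` into the labels of these paths. The same action shows that `G` is finitely generated.

Conversely, right multiplication by the identity of `G` retracts a path of `S` between elements of
`G`, labelled by generators of `G`, onto a path in `G`. Hence the loop problem of `G` is that of `S`
with respect to elements of `S` that need not generate it, a rational transduction of the loop
problem of `S`.
-/

section LabelledPath

variable {V V' B : Type*}

/-- `LabelledPath step v w v'`: the labelled graph with edges `step` has a path from `v` to `v'`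
labelled `w`. -/
def LabelledPath (step : V → B → V → Prop) : V → List B → V → Prop
  | v, [], v' => v = v'
  | v, b :: w, v' => ∃ u, step v b u ∧ LabelledPath step u w v'

/-- The set of labels of paths from `v` to `v'`. -/
def pathLanguage (step : V → B → V → Prop) (v v' : V) : Language B :=
  {w | LabelledPath step v w v'}

/-- The subgraph induced on the vertices satisfying `p`. -/
def restrictStep (step : V → B → V → Prop) (p : V → Prop) :
    {v // p v} → B → {v // p v} → Prop :=
  fun v b u => step v b u

variable {step : V → B → V → Prop}

theorem mem_pathLanguage {v v' : V} {w : List B} :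
    w ∈ pathLanguage step v v' ↔ LabelledPath step v w v' :=
  Iff.rfl

theorem LabelledPath.append_iff {v v' : V} {w w' : List B} :
    LabelledPath step v (w ++ w') v' ↔
      ∃ u, LabelledPath step v w u ∧ LabelledPath step u w' v' := by
  induction w generalizing v with
  | nil => simp [LabelledPath]
  | cons b w ih =>
    simp only [List.cons_append, LabelledPath, ih]
    constructor
    · rintro ⟨u, hu, t, h, h'⟩
      exact ⟨t, ⟨u, hu, h⟩, h'⟩
    · rintro ⟨t, ⟨u, hu, h⟩, h'⟩
      exact ⟨u, hu, t, h, h'⟩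

theorem LabelledPath.map {step' : V' → B → V' → Prop} {f : V → V'}
    (hf : ∀ v b u, step v b u → step' (f v) b (f u)) {v v' : V} {w : List B}
    (h : LabelledPath step v w v') : LabelledPath step' (f v) w (f v') := by
  induction w generalizing v with
  | nil => exact congrArg f h
  | cons b w ih =>
    obtain ⟨u, hu, h⟩ := h
    exact ⟨f u, hf _ _ _ hu, ih h⟩

theorem LabelledPath.exists_of_map {step' : V' → B → V' → Prop} {f : V → V'}
    (hf : ∀ v b u', step' (f v) b u' → ∃ u, f u = u' ∧ step v b u) {v : V} {v' : V'} {w : List B}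
    (h : LabelledPath step' (f v) w v') : ∃ u, f u = v' ∧ LabelledPath step v w u := by
  induction w generalizing v with
  | nil => exact ⟨v, h, rfl⟩
  | cons b w ih =>
    obtain ⟨u', hu', h⟩ := h
    obtain ⟨u, rfl, hu⟩ := hf _ _ _ hu'
    obtain ⟨t, ht, h⟩ := ih h
    exact ⟨t, ht, u, hu, h⟩

theorem LabelledPath.reverse_iff {v v' : V} {w : List B} :
    LabelledPath (fun v b u => step u b v) v' w.reverse v ↔ LabelledPath step v w v' := by
  induction w generalizing v with
  | nil => exact eq_comm
  | cons b w ih =>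
    simp only [List.reverse_cons, LabelledPath.append_iff, ih]
    constructor
    · rintro ⟨u, h, t, ht, rfl⟩
      exact ⟨u, ht, h⟩
    · rintro ⟨u, hu, h⟩
      exact ⟨u, h, v, hu, rfl⟩

theorem pathLanguage_eq_reverse (v v' : V) :
    pathLanguage step v v' = (pathLanguage (fun v b u => step u b v) v' v).reverse := by
  ext w
  rw [Language.mem_reverse]
  exact LabelledPath.reverse_iff.symm

theorem pathLanguage_mul_le (v u v' : V) :
    pathLanguage step v u * pathLanguage step u v' ≤ pathLanguage step v v' := by
  intro w hw
  obtain ⟨w₁, h₁, w₂, h₂, rfl⟩ := Language.mem_mul.1 hw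
  exact LabelledPath.append_iff.2 ⟨u, h₁, h₂⟩

theorem pathLanguage_eq_add_mul {z v v' : V} (hv : v ≠ z) (hv' : v' ≠ z) :
    pathLanguage step v v' =
      pathLanguage (restrictStep step (· ≠ z)) ⟨v, hv⟩ ⟨v', hv'⟩ +
        pathLanguage step v z * pathLanguage step z v' := by
  ext w
  rw [Language.mem_add]
  refine ⟨fun h => ?_, ?_⟩
  · induction w generalizing v with
    | nil => exact Or.inl (Subtype.ext h)
    | cons b w ih =>
      obtain ⟨u, hu, h⟩ := h
      obtain rfl | huz := eq_or_ne u z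
      · exact Or.inr (Language.mem_mul.2 ⟨[b], ⟨u, hu, rfl⟩, w, h, rfl⟩)
      · refine (ih huz h).imp (fun h => ⟨⟨u, huz⟩, hu, h⟩) fun h => ?_
        obtain ⟨w₁, h₁, w₂, h₂, rfl⟩ := Language.mem_mul.1 h
        exact Language.mem_mul.2 ⟨b :: w₁, ⟨u, hu, h₁⟩, w₂, h₂, rfl⟩
  · rintro (h | h)
    · exact LabelledPath.map (f := Subtype.val) (fun _ _ _ => id) h
    · exact pathLanguage_mul_le v z v' h

end LabelledPath

section Regular

variable {B : Type*}

theorem isRegular_of_finite {L : Language B} (hL : {w | w ∈ L}.Finite) : L.IsRegular := by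
  have hsuffixes : (⋃ w ∈ {w | w ∈ L}, {v | v ∈ w.tails}).Finite :=
    hL.biUnion fun w _ => w.tails.finite_toSet
  refine .of_finite_range_leftQuotient (hsuffixes.finite_subsets.subset ?_)
  rintro _ ⟨x, rfl⟩ y hy
  exact Set.mem_biUnion hy ((List.mem_tails _ _).2 (List.suffix_append x y))

theorem isRegular_singleton (w : List B) : ({w} : Language B).IsRegular :=
  isRegular_of_finite (Set.finite_singleton w)

theorem isRegular_zero : (0 : Language B).IsRegular :=
  isRegular_of_finite Set.finite_empty

theorem isRegular_pathLanguage_of_finite_range {V : Type*} {step : V → B → V → Prop} {v v' : V}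
    (hfin : (Set.range fun u => pathLanguage step u v').Finite) :
    (pathLanguage step v v').IsRegular := by
  refine .of_finite_range_leftQuotient ((hfin.finite_subsets.image sSup).subset ?_)
  rintro _ ⟨x, rfl⟩
  refine ⟨(fun u => pathLanguage step u v') '' {u | LabelledPath step v x u},
    Set.image_subset_range _ _, ?_⟩
  ext y
  rw [sSup_image, Language.mem_leftQuotient, mem_pathLanguage, LabelledPath.append_iff]
  simp only [Language.mem_iSup, Set.mem_ofPred_eq, mem_pathLanguage, exists_prop]

end Regular

namespace LanguageFamily

variable {F : LanguageFamily}

/-- `F` contains every regular language over a finite alphabet. -/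
def ContainsRegular (F : LanguageFamily) : Prop :=
  ∀ (B : Type) [Finite B] (R : Language B), R.IsRegular → R ∈ F B

theorem iSup_mem (hU : F.ClosedUnderUnion) {A : Type} [Finite A] (h0 : (0 : Language A) ∈ F A)
    {ι : Type*} [Finite ι] {L : ι → Language A} (hL : ∀ i, L i ∈ F A) : (⨆ i, L i) ∈ F A := by
  classical
  have := Fintype.ofFinite ι
  have hsup : ∀ s : Finset ι, s.sup L ∈ F A := fun s =>
    Finset.sup_induction h0 (fun K hK K' hK' => hU A K K' hK hK') fun i _ => hL i
  simpa only [Finset.sup_univ_eq_iSup] using hsup Finset.univ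

end LanguageFamily

theorem mem_inverseMorphism_image {A B : Type} [Finite B] (f : B → List A) (L : Language A)
    (v : List B) : v ∈ (inverseMorphism f).image L ↔ v.flatMap f ∈ L := by
  constructor
  · rintro ⟨u, hu, p, -, q, -, hp⟩
    rw [inverseMorphism_path] at hp
    exact hp ▸ hu
  · exact fun hv => ⟨_, hv, (), trivial, (), trivial, (inverseMorphism_path _ _ _ _ _).2 rfl⟩

/-- The transducer that reads the empty word and writes the words accepted by `M`. -/
def acceptedWordsTransducer (A : Type) {B Q : Type} [Finite B] [Finite Q] (M : DFA B Q) :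
    FinTransducer A B where
  State := Q
  finite_state := inferInstance
  trans := Set.range fun x : Q × B => (x.1, [], [x.2], M.step x.1 x.2)
  finite_trans := Set.finite_range _
  start := {M.start}
  accept := M.accept

theorem acceptedWordsTransducer_path {A B Q : Type} [Finite B] [Finite Q] {M : DFA B Q}
    {p q : (acceptedWordsTransducer A M).State} {u : List A} {v : List B} :
    (acceptedWordsTransducer A M).Path p u v q ↔ u = [] ∧ M.evalFrom p v = q := by
  constructor
  · intro h
    induction h with
    | nil => exact ⟨rfl, rfl⟩
    | cons h _ ih =>
      obtain ⟨⟨p, b⟩, hb⟩ := h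
      simp only at hb
      obtain ⟨rfl, rfl, rfl, rfl⟩ := hb
      exact ih
  · rintro ⟨rfl, rfl⟩
    induction v generalizing p with
    | nil => exact .nil p
    | cons b v ih =>
      exact .cons (v := [b]) (Set.mem_range_self (p, b)) ih

theorem LanguageFamily.containsRegular_of_nil_mem {F : LanguageFamily}
    (hT : F.ClosedUnderTransduction) {A : Type} [Finite A] {L : Language A} (hL : L ∈ F A)
    (hnil : [] ∈ L) : F.ContainsRegular := by
  rintro B _ _ ⟨Q, _, M, rfl⟩
  have himage : (acceptedWordsTransducer A M).image L = M.accepts := by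
    ext v
    constructor
    · rintro ⟨u, -, p, rfl, q, hq, h⟩
      obtain ⟨-, rfl⟩ := acceptedWordsTransducer_path.1 h
      exact hq
    · exact fun hv => ⟨[], hnil, M.start, rfl, _, hv, acceptedWordsTransducer_path.2 ⟨rfl, rfl⟩⟩
  exact himage ▸ hT A B _ L hL

section LoopProblem

variable {X M S : Type*}

/-- The edges of the loop automaton of `M` with respect to the elements `c x`. -/
def mulStep [Mul M] (c : X → M) : M → X ⊕ X → M → Prop
  | a, Sum.inl x, b => a * c x = b
  | a, Sum.inr x, b => b * c x = a

theorem mulStep.mul_left [Semigroup M] {c : X → M} {a b : M} {s : X ⊕ X} (m : M)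
    (h : mulStep c a s b) : mulStep c (m * a) s (m * b) := by
  cases s with
  | inl x => exact (mul_assoc m a (c x)).trans (congrArg (m * ·) h)
  | inr x => exact (mul_assoc m b (c x)).trans (congrArg (m * ·) h)

theorem mulStep.map {N : Type*} [Mul M] [Mul N] (f : M →ₙ* N) {c : X → M} {a b : M} {s : X ⊕ X}
    (h : mulStep c a s b) : mulStep (f ∘ c) (f a) s (f b) := by
  cases s with
  | inl x => exact (map_mul f a (c x)).symm.trans (congrArg f h)
  | inr x => exact (map_mul f b (c x)).symm.trans (congrArg f h)

theorem mem_loopAutomaton_evalFrom [Monoid M] (σ : FreeMonoid X →* M) (w : List (X ⊕ X))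
    (A : Set M) (b : M) :
    b ∈ (loopAutomaton σ).evalFrom A w ↔
      ∃ a ∈ A, LabelledPath (mulStep (σ ∘ FreeMonoid.of)) a w b := by
  induction w generalizing A with
  | nil => simp [LabelledPath]
  | cons s w ih =>
    have hstep : ∀ a u, u ∈ (loopAutomaton σ).step a s ↔ mulStep (σ ∘ FreeMonoid.of) a s u :=
      fun _ _ => by cases s <;> rfl
    rw [NFA.evalFrom_cons, ih]
    simp only [NFA.mem_stepSet, LabelledPath, hstep]
    constructor
    · rintro ⟨u, ⟨a, ha, hu⟩, h⟩
      exact ⟨a, ha, u, hu, h⟩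
    · rintro ⟨a, ha, u, hu, h⟩
      exact ⟨u, ⟨a, ha, hu⟩, h⟩

variable [Semigroup S] {c : X → S}

theorem mulStep_withOne_one_iff {b : X ⊕ X} {u : WithOne S} :
    mulStep (fun x => (c x : WithOne S)) 1 b u ↔ ∃ x, b = Sum.inl x ∧ u = c x := by
  cases b with
  | inl x => simp [mulStep, eq_comm]
  | inr x =>
    induction u using WithOne.recOneCoe with
    | one => simp [mulStep]
    | coe s => simp [mulStep, ← WithOne.coe_mul]

theorem mulStep_withOne_coe_one_iff {b : X ⊕ X} {s : S} :
    mulStep (fun x => (c x : WithOne S)) s b 1 ↔ ∃ y, b = Sum.inr y ∧ s = c y := by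
  cases b <;> simp [mulStep, ← WithOne.coe_mul, eq_comm]

theorem mulStep_withOne_coe_coe_iff {b : X ⊕ X} {s t : S} :
    mulStep (fun x => (c x : WithOne S)) s b t ↔ mulStep c s b t := by
  cases b <;> simp [mulStep, ← WithOne.coe_mul]

theorem LabelledPath.coe_withOne {s t : S} {w : List (X ⊕ X)}
    (h : LabelledPath (mulStep c) s w t) :
    LabelledPath (mulStep fun x => (c x : WithOne S)) s w t :=
  h.map fun _ _ _ => mulStep_withOne_coe_coe_iff.2

theorem LabelledPath.exists_first_return {s : S} {w : List (X ⊕ X)}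
    (h : LabelledPath (mulStep fun x => (c x : WithOne S)) s w 1) :
    ∃ w₁ y w₂, w = w₁ ++ Sum.inr y :: w₂ ∧ LabelledPath (mulStep c) s w₁ (c y) ∧
      LabelledPath (mulStep fun x => (c x : WithOne S)) 1 w₂ 1 := by
  induction w generalizing s with
  | nil => exact absurd h WithOne.coe_ne_one
  | cons b w ih =>
    obtain ⟨u, hu, h⟩ := h
    induction u using WithOne.recOneCoe with
    | one =>
      obtain ⟨y, rfl, rfl⟩ := mulStep_withOne_coe_one_iff.1 hu
      exact ⟨[], y, w, rfl, rfl, h⟩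
    | coe t =>
      obtain ⟨w₁, y, w₂, rfl, h₁, h₂⟩ := ih h
      exact ⟨b :: w₁, y, w₂, rfl, ⟨t, mulStep_withOne_coe_coe_iff.1 hu, h₁⟩, h₂⟩

/-- The set of labels of the loops at `1` in `S¹` that visit `1` only at their ends. -/
def firstReturnLanguage (c : X → S) : Language (X ⊕ X) :=
  ⨆ p : X × X,
    {[Sum.inl p.1]} * pathLanguage (mulStep c) (c p.1) (c p.2) * {[Sum.inr p.2]}

theorem mem_firstReturnLanguage {v : List (X ⊕ X)} :
    v ∈ firstReturnLanguage c ↔ ∃ x w y, LabelledPath (mulStep c) (c x) w (c y) ∧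
      Sum.inl x :: (w ++ [Sum.inr y]) = v := by
  rw [firstReturnLanguage, Language.mem_iSup]
  constructor
  · rintro ⟨⟨x, y⟩, h⟩
    obtain ⟨_, h₁, _, rfl, rfl⟩ := Language.mem_mul.1 h
    obtain ⟨_, rfl, w, h₂, rfl⟩ := Language.mem_mul.1 h₁
    exact ⟨x, w, y, h₂, rfl⟩
  · rintro ⟨x, w, y, h, rfl⟩
    exact ⟨(x, y), Language.mem_mul.2 ⟨Sum.inl x :: w,
      Language.mem_mul.2 ⟨[Sum.inl x], rfl, w, h, rfl⟩, [Sum.inr y], rfl, rfl⟩⟩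

theorem pathLanguage_one_eq_mul_add :
    pathLanguage (mulStep fun x => (c x : WithOne S)) 1 1 =
      firstReturnLanguage c * pathLanguage (mulStep fun x => (c x : WithOne S)) 1 1 + 1 := by
  ext w
  rw [Language.mem_add, Language.mem_mul, Language.mem_one]
  constructor
  · intro h
    match w, h with
    | [], _ => exact Or.inr rfl
    | b :: w, ⟨u, hu, h⟩ =>
      obtain ⟨x, rfl, rfl⟩ := mulStep_withOne_one_iff.1 hu
      obtain ⟨w₁, y, w₂, rfl, h₁, h₂⟩ := h.exists_first_return
      exact Or.inl ⟨_, mem_firstReturnLanguage.2 ⟨x, w₁, y, h₁, rfl⟩, w₂, h₂, by simp⟩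
  · rintro (⟨v, hv, w, hw, rfl⟩ | rfl)
    · obtain ⟨x, w₁, y, h₁, rfl⟩ := mem_firstReturnLanguage.1 hv
      exact LabelledPath.append_iff.2 ⟨1, ⟨c x, mulStep_withOne_one_iff.2 ⟨x, rfl, rfl⟩,
        LabelledPath.append_iff.2 ⟨c y, h₁.coe_withOne, 1,
          mulStep_withOne_coe_one_iff.2 ⟨y, rfl, rfl⟩, rfl⟩⟩, hw⟩
    · rfl

theorem loopProblem_eq_pathLanguage (σ : FreeSemigroup X →ₙ* S) :
    loopProblem σ =
      pathLanguage (mulStep fun x => ((σ (FreeSemigroup.of x) : S) : WithOne S)) 1 1 := by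
  ext w
  have hgen : extendOne σ ∘ FreeMonoid.of = fun x => ((σ (FreeSemigroup.of x) : S) : WithOne S) :=
    funext fun x => FreeMonoid.lift_eval_of _ x
  have haccept : w ∈ loopProblem σ ↔ 1 ∈ (loopAutomaton (extendOne σ)).evalFrom {1} w :=
    exists_eq_left
  rw [haccept, mem_loopAutomaton_evalFrom, hgen]
  exact exists_eq_left

/-- Arden's rule, applied to the decomposition of a loop at its first return to `1`. -/
theorem loopProblem_eq_kstar (σ : FreeSemigroup X →ₙ* S) :
    loopProblem σ = KStar.kstar (firstReturnLanguage (σ ∘ FreeSemigroup.of)) := by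
  have hnil : [] ∉ firstReturnLanguage (σ ∘ FreeSemigroup.of) := fun h => by
    obtain ⟨x, w, y, -, h⟩ := mem_firstReturnLanguage.1 h
    exact List.cons_ne_nil _ _ h
  rw [loopProblem_eq_pathLanguage, ← mul_one (KStar.kstar _)]
  exact (Language.self_eq_mul_add_iff hnil).1 pathLanguage_one_eq_mul_add

theorem nil_mem_loopProblem (σ : FreeSemigroup X →ₙ* S) : [] ∈ loopProblem σ := by
  rw [loopProblem_eq_pathLanguage]
  rfl

variable {F : LanguageFamily}

theorem HasLoopProblemIn.containsRegular (hT : F.ClosedUnderTransduction)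
    (h : HasLoopProblemIn F S) : F.ContainsRegular := by
  obtain ⟨X, _, σ, -, hσ⟩ := h
  exact LanguageFamily.containsRegular_of_nil_mem hT hσ (nil_mem_loopProblem σ)

theorem loopProblem_mem_of_pathLanguage_mem (hU : F.ClosedUnderUnion)
    (hP : F.ClosedUnderProduct) (hK : F.ClosedUnderKleene) (hR : F.ContainsRegular)
    {X : Type} [Finite X] (σ : FreeSemigroup X →ₙ* S)
    (h : ∀ s t, pathLanguage (mulStep (σ ∘ FreeSemigroup.of)) s t ∈ F (X ⊕ X)) :
    loopProblem σ ∈ F (X ⊕ X) := by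
  rw [loopProblem_eq_kstar]
  exact hK _ _ <| LanguageFamily.iSup_mem hU (hR _ _ isRegular_zero) fun p =>
    hP _ _ _ (hP _ _ _ (hR _ _ (isRegular_singleton _)) (h _ _)) (hR _ _ (isRegular_singleton _))

end LoopProblem

section Group

variable {F : LanguageFamily} {G : Type*} [Group G]

section Subgroup

variable {S : Type*} [Semigroup S] {ι : G →ₙ* S} {X : Type*} {c : X → G}

theorem mulStep.exists_of_mul_map_one {g : G} {s u : S} {b : X ⊕ X} (hs : s * ι 1 = ι g)
    (h : mulStep (ι ∘ c) s b u) : ∃ k, u * ι 1 = ι k ∧ mulStep c g b k := by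
  cases b with
  | inl x =>
    refine ⟨g * c x, ?_, rfl⟩
    calc u * ι 1 = s * ι (c x) * ι 1 := congrArg (· * ι 1) h.symm
      _ = s * ι 1 * ι (c x) := by simp only [mul_assoc, ← map_mul, mul_one, one_mul]
      _ = ι (g * c x) := by rw [hs, map_mul]
  | inr x =>
    refine ⟨g * (c x)⁻¹, ?_, inv_mul_cancel_right g (c x)⟩
    calc u * ι 1 = u * ι (c x) * ι (c x)⁻¹ := by rw [mul_assoc, ← map_mul, mul_inv_cancel]
      _ = s * ι (c x)⁻¹ := congrArg (· * ι (c x)⁻¹) h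
      _ = s * ι 1 * ι (c x)⁻¹ := by rw [mul_assoc, ← map_mul, one_mul]
      _ = ι (g * (c x)⁻¹) := by rw [hs, map_mul]

/-- A path that starts and ends in `G` may leave `G`; right multiplication by the identity of `G`
retracts it to a path in `G`. -/
theorem LabelledPath.of_map_of_mul_map_one (hι : Function.Injective ι) {g h : G} {s : S}
    {w : List (X ⊕ X)} (hs : s * ι 1 = ι g) (hw : LabelledPath (mulStep (ι ∘ c)) s w (ι h)) :
    LabelledPath (mulStep c) g w h := by
  induction w generalizing s g with
  | nil =>
    obtain rfl : s = ι h := hw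
    rw [← map_mul, mul_one] at hs
    exact (hι hs).symm
  | cons b w ih =>
    obtain ⟨u, hu, hw⟩ := hw
    obtain ⟨k, huk, hk⟩ := hu.exists_of_mul_map_one hs
    exact ⟨k, hk, ih huk hw⟩

theorem pathLanguage_mulStep_map (hι : Function.Injective ι) (g h : G) :
    pathLanguage (mulStep (ι ∘ c)) (ι g) (ι h) = pathLanguage (mulStep c) g h :=
  Set.Subset.antisymm
    (fun _ hw => LabelledPath.of_map_of_mul_map_one hι (by rw [← map_mul, mul_one]) hw)
    fun _ hw => LabelledPath.map (fun _ _ _ => mulStep.map ι) hw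

theorem loopProblem_comp (hι : Function.Injective ι) (τ : FreeSemigroup X →ₙ* G) :
    loopProblem (ι.comp τ) = loopProblem τ := by
  have hfirst : firstReturnLanguage (ι ∘ τ ∘ FreeSemigroup.of) =
      firstReturnLanguage (τ ∘ FreeSemigroup.of) := by
    simp only [firstReturnLanguage, Function.comp_apply, ← pathLanguage_mulStep_map hι]
  rw [loopProblem_eq_kstar, loopProblem_eq_kstar, ← hfirst]
  rfl

theorem HasLoopProblemIn.of_injective (hT : F.ClosedUnderTransduction)
    (hS : HasLoopProblemIn F S) (hι : Function.Injective ι) (hG : IsFinGenSemigroup G) :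
    HasLoopProblemIn F G := by
  obtain ⟨Y, _, τ, hτ⟩ := hG
  exact ⟨Y, ‹_›, τ, hτ, loopProblem_comp hι τ ▸ hS.loopProblem_mem hT (ι.comp τ)⟩

end Subgroup

section WordProblem

variable {A : Type*} {f : A → G}

/-- The word problem of `G` with respect to the elements `f a`: the words over `A` with
product `1`. No letters for inverses are adjoined. -/
def wordProblem (f : A → G) : Language A :=
  {u | (u.map f).prod = 1}

/-- The loop `none · a · none⁻¹`, where the letter `none` stands for the identity of the group `G`.
In `G¹` it reads the element `a` of `G` while leaving and re-entering the adjoined identity. -/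
def bracketLetter (a : A) : List (Option A ⊕ Option A) :=
  [Sum.inl none, Sum.inl (some a), Sum.inr none]

theorem mul_prod_eq_of_labelledPath {g h : G} {w : List A}
    (hw : LabelledPath (mulStep fun o => o.elim 1 f) g (w.flatMap bracketLetter) h) :
    g * (w.map f).prod = h := by
  induction w generalizing g with
  | nil => exact (mul_one g).trans hw
  | cons a w ih =>
    obtain ⟨_, rfl, _, rfl, k, hk, hw⟩ := hw
    obtain rfl : k = g * f a := by simpa [mulStep] using hk
    rw [List.map_cons, List.prod_cons, ← mul_assoc]
    exact ih hw

theorem labelledPath_of_mul_prod_eq_one {a : A} {w : List A} {v : WithOne G} {g : G}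
    (hv : v * (1 : G) = g) (h : g * ((a :: w).map f).prod = 1) :
    LabelledPath (mulStep fun o => ((o.elim 1 f : G) : WithOne G)) v
      ((a :: w).flatMap bracketLetter) 1 := by
  rw [List.map_cons, List.prod_cons, ← mul_assoc] at h
  have hone (k : G) : (k : WithOne G) * (1 : G) = k := congrArg _ (mul_one k)
  induction w generalizing a g v with
  | nil =>
    have hone_eq : 1 * ((1 : G) : WithOne G) = (g * f a : G) := by
      rw [one_mul, ← h, List.map_nil, List.prod_nil, mul_one]
    exact ⟨g, hv, (g * f a : G), rfl, 1, hone_eq, rfl⟩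
  | cons a' w ih =>
    rw [List.map_cons, List.prod_cons, ← mul_assoc] at h
    exact ⟨g, hv, (g * f a : G), rfl, (g * f a : G), hone _, ih (hone _) h⟩

theorem flatMap_bracketLetter_mem_loopProblem_iff {w : List A} :
    w.flatMap bracketLetter ∈ loopProblem (FreeSemigroup.lift fun o => o.elim 1 f) ↔
      w ∈ wordProblem f := by
  rw [loopProblem_eq_pathLanguage]
  simp only [FreeSemigroup.lift_of]
  constructor
  · intro h
    have hG := h.map (step' := mulStep fun o => o.elim 1 f)
      fun _ _ _ => mulStep.map (WithOne.lift (MulHom.id G)).toMulHom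
    exact (one_mul _).symm.trans (mul_prod_eq_of_labelledPath hG)
  · intro h
    cases w with
    | nil => rfl
    | cons a w => exact labelledPath_of_mul_prod_eq_one (one_mul _) ((one_mul _).trans h)

theorem HasLoopProblemIn.wordProblem_mem (hT : F.ClosedUnderTransduction)
    (hG : HasLoopProblemIn F G) {A : Type} [Finite A] (f : A → G) : wordProblem f ∈ F A := by
  have himage : (inverseMorphism bracketLetter).image
      (loopProblem (FreeSemigroup.lift fun o => o.elim 1 f)) = wordProblem f :=
    Language.ext fun w => (mem_inverseMorphism_image _ _ w).trans
      flatMap_bracketLetter_mem_loopProblem_iff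
  exact himage ▸ hT _ _ _ _ (hG.loopProblem_mem hT _)

end WordProblem

end Group

section MulAction

theorem isFinGenSemigroup_of_forall_prod {M A : Type*} [Monoid M] [Finite A] {f : A → M}
    (hf : ∀ m, ∃ u : List A, (u.map f).prod = m) : IsFinGenSemigroup M := by
  obtain ⟨n, ⟨φ⟩⟩ := Finite.exists_equiv_fin A
  let σ : FreeSemigroup (Option (Fin n)) →ₙ* M :=
    FreeSemigroup.lift fun o => o.elim 1 (f ∘ φ.symm)
  refine ⟨Option (Fin n), inferInstance, σ, fun m => ?_⟩
  obtain ⟨u, rfl⟩ := hf m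
  induction u with
  | nil => exact ⟨FreeSemigroup.of none, FreeSemigroup.lift_of _ _⟩
  | cons a u ih =>
    obtain ⟨t, ht⟩ := ih
    refine ⟨FreeSemigroup.of (some (φ a)) * t, ?_⟩
    rw [map_mul, ht, List.map_cons, List.prod_cons, FreeSemigroup.lift_of]
    simp

variable {F : LanguageFamily} {A B Q : Type} {G V : Type*} [Group G] [MulAction G V]

/-- `G` acts on the labelled graph `step` by automorphisms, properly (finitely many group elements
map a given vertex to a given vertex, or to a neighbour of a given vertex along a given label) and
with finitely many orbits of vertices. -/
structure IsProperCocompact (G : Type*) [Group G] [MulAction G V] (step : V → B → V → Prop) :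
    Prop where
  map_step : ∀ (g : G) v b u, step v b u → step (g • v) b (g • u)
  finite_eq_smul : ∀ v u : V, {g : G | v = g • u}.Finite
  finite_step_smul : ∀ v b u, {g : G | step v b (g • u)}.Finite
  exists_finite_representatives : ∃ s : Set V, s.Finite ∧ ∀ v, ∃ g : G, ∃ u ∈ s, v = g • u

variable {step : V → B → V → Prop} {r : Q → V} {f : A → G}

/-- The elements `g` of `G` for which some representative `r p` is equal or adjacent to some
`g • r q`. -/
def connectingElements (G : Type*) [Group G] [MulAction G V] (step : V → B → V → Prop)
    (r : Q → V) : Set G :=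
  {g | ∃ p q, ∃ o : Option B, LabelledPath step (r p) o.toList (g • r q)}

theorem IsProperCocompact.finite_connectingElements [Finite B] [Finite Q]
    (h : IsProperCocompact G step) : (connectingElements G step r).Finite := by
  have hfin (p q : Q) (o : Option B) :
      {g : G | LabelledPath step (r p) o.toList (g • r q)}.Finite := by
    cases o with
    | none => exact h.finite_eq_smul _ _
    | some b =>
      refine (h.finite_step_smul (r p) b (r q)).subset ?_
      rintro g ⟨_, hu, rfl⟩
      exact hu
  exact (Set.finite_iUnion fun p => Set.finite_iUnion fun q => Set.finite_iUnion (hfin p q)).subset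
    fun g ⟨p, q, o, hg⟩ => Set.mem_iUnion₂.2 ⟨p, q, Set.mem_iUnion.2 ⟨o, hg⟩⟩

/-- Its states stand for the orbits of the vertices `r p`. While it writes the label of a path
`r p → g • r q`, it reads a word in the letters `f a` with product `g`. -/
def orbitTransducer [Finite A] [Finite B] [Finite Q] (f : A → G) (step : V → B → V → Prop)
    (r : Q → V) (p q : Q) : FinTransducer A B where
  State := Q
  finite_state := inferInstance
  trans := (fun x : Q × A × Option B × Q => (x.1, [x.2.1], x.2.2.1.toList, x.2.2.2)) ''
    {x | LabelledPath step (r x.1) x.2.2.1.toList (f x.2.1 • r x.2.2.2)}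
  finite_trans := (Set.toFinite _).image _
  start := {p}
  accept := {q}

section orbitTransducer

variable [Finite A] [Finite B] [Finite Q] {p₀ q₀ : Q}

theorem mem_orbitTransducer_trans {p q : Q} {a : A} (o : Option B)
    (h : LabelledPath step (r p) o.toList (f a • r q)) :
    (p, [a], o.toList, q) ∈ (orbitTransducer f step r p₀ q₀).trans :=
  ⟨(p, a, o, q), h, rfl⟩

theorem labelledPath_of_orbitTransducer_path
    (hstep : ∀ (g : G) v b u, step v b u → step (g • v) b (g • u))
    {p q : (orbitTransducer f step r p₀ q₀).State} {u : List A} {v : List B}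
    (h : (orbitTransducer f step r p₀ q₀).Path p u v q) :
    LabelledPath step (r p) v ((u.map f).prod • r q) := by
  induction h with
  | nil => exact (one_smul _ _).symm
  | cons h _ ih =>
    obtain ⟨⟨p, a, o, q⟩, hx, hq⟩ := h
    simp only at hq
    obtain ⟨rfl, rfl, rfl, rfl⟩ := hq
    rw [List.map_append, List.prod_append, mul_smul, List.map_singleton, List.prod_singleton]
    exact LabelledPath.append_iff.2 ⟨_, hx, ih.map (hstep (f a))⟩

theorem exists_orbitTransducer_path
    (hstep : ∀ (g : G) v b u, step v b u → step (g • v) b (g • u))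
    (hr : ∀ v, ∃ (g : G) (q : Q), v = g • r q) (hf : connectingElements G step r ⊆ Set.range f)
    {p q : Q} {g : G} {v : List B} (h : LabelledPath step (r p) v (g • r q)) :
    ∃ u, (u.map f).prod = g ∧ (orbitTransducer f step r p₀ q₀).Path p u v q := by
  induction v generalizing p g with
  | nil =>
    obtain ⟨a, rfl⟩ := hf ⟨p, q, none, h⟩
    exact ⟨[a], List.prod_singleton, .cons (mem_orbitTransducer_trans none h) (.nil _)⟩
  | cons b v ih =>
    obtain ⟨w, hw, h⟩ := h
    obtain ⟨k, t, rfl⟩ := hr w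
    obtain ⟨a, rfl⟩ := hf ⟨p, t, some b, _, hw, rfl⟩
    have h' := h.map (hstep (f a)⁻¹)
    rw [inv_smul_smul, smul_smul] at h'
    obtain ⟨u, hu, hpath⟩ := ih h'
    exact ⟨a :: u, by rw [List.map_cons, List.prod_cons, hu, mul_inv_cancel_left],
      .cons (mem_orbitTransducer_trans (some b) ⟨_, hw, rfl⟩) hpath⟩

theorem orbitTransducer_image_wordProblem
    (hstep : ∀ (g : G) v b u, step v b u → step (g • v) b (g • u))
    (hr : ∀ v, ∃ (g : G) (q : Q), v = g • r q) (hf : connectingElements G step r ⊆ Set.range f)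
    (p q : Q) :
    (orbitTransducer f step r p q).image (wordProblem f) = pathLanguage step (r p) (r q) := by
  ext v
  constructor
  · rintro ⟨u, hu, p', hp, q', hq, h⟩
    have hpath := labelledPath_of_orbitTransducer_path hstep h
    rwa [show p' = p from hp, show q' = q from hq, show (u.map f).prod = 1 from hu,
      one_smul] at hpath
  · intro h
    rw [mem_pathLanguage, ← one_smul G (r q)] at h
    obtain ⟨u, hu, hpath⟩ := exists_orbitTransducer_path hstep hr hf h
    exact ⟨u, hu, p, rfl, q, rfl, hpath⟩

end orbitTransducer

namespace IsProperCocompact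

variable [Finite B]

theorem exists_representatives (h : IsProperCocompact G step) (v v' : V) :
    ∃ (n m : ℕ) (r : Fin n → V) (f : Fin m → G), v ∈ Set.range r ∧ v' ∈ Set.range r ∧
      (∀ u, ∃ (g : G) (q : Fin n), u = g • r q) ∧ connectingElements G step r ⊆ Set.range f := by
  obtain ⟨s, hs, hsV⟩ := h.exists_finite_representatives
  obtain ⟨n, r, -, hr⟩ := ((hs.insert v').insert v).fin_param
  obtain ⟨m, f, -, hf⟩ := (h.finite_connectingElements (r := r)).fin_param
  refine ⟨n, m, r, f, hr ▸ Set.mem_insert _ _, hr ▸ Set.mem_insert_of_mem _ (Set.mem_insert _ _),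
    fun u => ?_, hf.ge⟩
  obtain ⟨g, u', hu', rfl⟩ := hsV u
  obtain ⟨q, rfl⟩ : u' ∈ Set.range r :=
    hr ▸ Set.mem_insert_of_mem _ (Set.mem_insert_of_mem _ hu')
  exact ⟨g, q, rfl⟩

theorem pathLanguage_mem (hT : F.ClosedUnderTransduction) (hG : HasLoopProblemIn F G)
    (h : IsProperCocompact G step) (v v' : V) : pathLanguage step v v' ∈ F B := by
  obtain ⟨n, m, r, f, ⟨p, rfl⟩, ⟨q, rfl⟩, hr, hf⟩ := h.exists_representatives v v'
  exact orbitTransducer_image_wordProblem h.map_step hr hf p q ▸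
    hT _ _ _ _ (hG.wordProblem_mem hT f)

theorem isFinGenSemigroup (h : IsProperCocompact G step) (v : V)
    (hv : ∀ g : G, ∃ w, LabelledPath step v w (g • v)) : IsFinGenSemigroup G := by
  obtain ⟨n, m, r, f, ⟨p, rfl⟩, -, hr, hf⟩ := h.exists_representatives v v
  refine isFinGenSemigroup_of_forall_prod (f := f) fun g => ?_
  obtain ⟨w, hw⟩ := hv g
  obtain ⟨u, hu, -⟩ := exists_orbitTransducer_path (p₀ := p) (q₀ := p) h.map_step hr hf hw
  exact ⟨u, hu⟩

end IsProperCocompact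

end MulAction

section CompletelyZeroSimple

variable {S : Type*} [SemigroupWithZero S]

theorem IsZeroSimple.exists_mul_eq (hS : IsZeroSimple S) (s : S) : ∃ p q, p * q = s := by
  obtain ⟨⟨a, b, hab⟩, hI⟩ := hS
  have hideal : IsIdealOf {s : S | ∃ p q, p * q = s} :=
    ⟨⟨_, a, b, rfl⟩, fun s _ u => ⟨⟨u, s, rfl⟩, ⟨s, u, rfl⟩⟩⟩
  rcases hI _ hideal with h | h
  · exact absurd (h.le ⟨a, b, rfl⟩ : a * b = 0) hab
  · exact h.ge (Set.mem_univ s)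

theorem IsZeroSimple.exists_mul_mul_ne_zero (hS : IsZeroSimple S) {a : S} (ha : a ≠ 0) :
    ∃ x y, x * a * y ≠ 0 := by
  by_contra! hann
  have hideal : IsIdealOf {c : S | ∀ x y : S, x * c * y = 0} := by
    refine ⟨⟨0, fun x y => by rw [mul_zero, zero_mul]⟩,
      fun c hc s => ⟨fun x y => ?_, fun x y => ?_⟩⟩
    · rw [← mul_assoc x, hc]
    · rw [← mul_assoc x, mul_assoc _ s, hc]
  obtain ⟨s, t, hst⟩ := hS.1
  rcases hS.2 _ hideal with h | h
  · exact ha (h.le hann)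
  · obtain ⟨p, q, rfl⟩ := hS.exists_mul_eq s
    exact hst ((h.ge (Set.mem_univ q) : ∀ x y : S, x * q * y = 0) p t)

theorem IsZeroSimple.exists_mul_mul_eq (hS : IsZeroSimple S) {a : S} (ha : a ≠ 0) (b : S) :
    ∃ x y, x * a * y = b := by
  obtain ⟨x, y, hxy⟩ := hS.exists_mul_mul_ne_zero ha
  have hideal : IsIdealOf {b | ∃ x y : S, x * a * y = b} := by
    refine ⟨⟨_, x, y, rfl⟩, ?_⟩
    rintro _ ⟨x, y, rfl⟩ s
    exact ⟨⟨s * x, y, by simp only [mul_assoc]⟩, ⟨x, y * s, by simp only [mul_assoc]⟩⟩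
  rcases hS.2 _ hideal with h | h
  · exact absurd (h.le ⟨x, y, rfl⟩ : x * a * y = 0) hxy
  · exact h.ge (Set.mem_univ b)

namespace IsPrimitiveIdempotent

variable {e : S}

theorem mul_mul_eq_of_mul_eq (he : IsPrimitiveIdempotent e) {p q : S} (hpq : p * q = e)
    (hq : e * q = q) (hp : p * e = p) : q * e * p = e := by
  obtain ⟨he0, hee, hmin⟩ := he
  have hcube : p * (q * e * p) * q = e := by
    calc p * (q * e * p) * q = p * q * e * (p * q) := by simp only [mul_assoc]
      _ = e := by rw [hpq, hee.eq, hee.eq]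
  refine hmin _ (fun h => he0 ?_) ?_ (by rw [← mul_assoc, ← mul_assoc, hq])
    (by rw [mul_assoc, hp])
  · rw [← hcube, h, mul_zero, zero_mul]
  · calc q * e * p * (q * e * p) = q * (e * (p * q) * e) * p := by simp only [mul_assoc]
      _ = q * e * p := by rw [hpq, hee.eq, hee.eq]

theorem exists_mul_eq_of_mul_eq (hS : IsZeroSimple S) (he : IsPrimitiveIdempotent e) {a : S}
    (ha : a ≠ 0) (hae : a * e = a) : ∃ x, x * a = e := by
  obtain ⟨x, y, hxy⟩ := hS.exists_mul_mul_eq ha e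
  have h := he.mul_mul_eq_of_mul_eq (p := x * a) (q := e * y)
    (by rw [← mul_assoc, mul_assoc x, hae, hxy]) (by rw [← mul_assoc, he.2.1.eq])
    (by rw [mul_assoc, hae])
  exact ⟨e * y * e * x, by rw [mul_assoc, h]⟩

theorem exists_mul_eq_of_eq_mul (hS : IsZeroSimple S) (he : IsPrimitiveIdempotent e) {b : S}
    (hb : b ≠ 0) (heb : e * b = b) : ∃ y, b * y = e := by
  obtain ⟨x, y, hxy⟩ := hS.exists_mul_mul_eq hb e
  have h := he.mul_mul_eq_of_mul_eq (p := x * e) (q := b * y)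
    (by rw [mul_assoc, ← mul_assoc e, heb, ← mul_assoc, hxy]) (by rw [← mul_assoc, heb])
    (by rw [mul_assoc, he.2.1.eq])
  exact ⟨y * e * (x * e), by simpa only [mul_assoc] using h⟩

end IsPrimitiveIdempotent

namespace IsCompletelyZeroSimple

variable (hS : IsCompletelyZeroSimple S) {e : S}

include hS

theorem exists_mul_mul_eq_right {u s : S} (hus : u * s ≠ 0) : ∃ m, m * (u * s) = s := by
  obtain ⟨hS, e, he⟩ := hS
  obtain ⟨x, y, rfl⟩ := hS.exists_mul_mul_eq he.1 s
  obtain ⟨c, hc⟩ := he.exists_mul_eq_of_mul_eq hS (a := u * (x * e))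
    (fun h => hus (by rw [← mul_assoc, h, zero_mul])) (by rw [mul_assoc, mul_assoc, he.2.1.eq])
  refine ⟨x * c, ?_⟩
  calc x * c * (u * (x * e * y)) = x * (c * (u * (x * e))) * y := by simp only [mul_assoc]
    _ = x * e * y := by rw [hc]

theorem exists_mul_mul_eq_left {s u : S} (hsu : s * u ≠ 0) : ∃ z, s * u * z = s := by
  obtain ⟨hS, e, he⟩ := hS
  obtain ⟨x, y, rfl⟩ := hS.exists_mul_mul_eq he.1 s
  obtain ⟨c, hc⟩ := he.exists_mul_eq_of_eq_mul hS (b := e * y * u)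
    (fun h => hsu (by rw [mul_assoc x, mul_assoc x, h, mul_zero]))
    (by rw [← mul_assoc, ← mul_assoc, he.2.1.eq])
  refine ⟨c * y, ?_⟩
  calc x * e * y * u * (c * y) = x * (e * y * u * c) * y := by simp only [mul_assoc]
    _ = x * e * y := by rw [hc]

theorem mul_ne_zero {a b : S} (ha : a ≠ 0) (hae : a * e = a) (hb : b ≠ 0) (heb : e * b = b) :
    a * b ≠ 0 := fun hab => by
  obtain ⟨m, hm⟩ := hS.exists_mul_mul_eq_right (hae.symm ▸ ha)
  exact hb (by rw [← heb, ← hm, hae, mul_assoc, hab, mul_zero])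

omit hS in
/-- The subsemigroup of the non-zero elements of `eSe`. For `e` a non-zero idempotent these are the
non-zero maximal subgroups of `S`. -/
def nonzeroCorner (hS : IsCompletelyZeroSimple S) (e : S) : Subsemigroup S where
  carrier := {a | a ≠ 0 ∧ e * a = a ∧ a * e = a}
  mul_mem' := fun {a b} ⟨ha, hea, hae⟩ ⟨hb, heb, hbe⟩ =>
    ⟨hS.mul_ne_zero ha hae hb heb, by rw [← mul_assoc, hea], by rw [mul_assoc, hbe]⟩

theorem exists_eq_mul (he0 : e ≠ 0) (hee : IsIdempotentElem e) {s : S} (hs : s ≠ 0) :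
    ∃ a v, (a ≠ 0 ∧ a * e = a) ∧ (v ≠ 0 ∧ e * v = v) ∧ a * v = s := by
  obtain ⟨x, y, hxy⟩ := hS.1.exists_mul_mul_eq he0 s
  have hmul : x * e * (e * y) = s := by rw [← mul_assoc, mul_assoc x, hee.eq, hxy]
  refine ⟨x * e, e * y, ⟨fun h => hs ?_, ?_⟩, ⟨fun h => hs ?_, ?_⟩, hmul⟩
  · rw [← hmul, h, zero_mul]
  · rw [mul_assoc, hee.eq]
  · rw [← hmul, h, mul_zero]
  · rw [← mul_assoc, hee.eq]

theorem mul_left_cancel {a v v' : S} (ha : a ≠ 0) (hae : a * e = a) (hv : e * v = v)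
    (hv' : e * v' = v') (h : a * v = a * v') : v = v' := by
  obtain ⟨m, hm⟩ := hS.exists_mul_mul_eq_right (hae.symm ▸ ha)
  rw [hae] at hm
  rw [← hv, ← hv', ← hm, mul_assoc, mul_assoc, h]

theorem mul_right_cancel {a a' v : S} (hv : v ≠ 0) (hev : e * v = v) (ha : a * e = a)
    (ha' : a' * e = a') (h : a * v = a' * v) : a = a' := by
  obtain ⟨z, hz⟩ := hS.exists_mul_mul_eq_left (hev.symm ▸ hv)
  rw [hev] at hz
  rw [← ha, ← ha', ← hz, ← mul_assoc, ← mul_assoc, h]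

theorem isGroup_nonzeroCorner (he0 : e ≠ 0) (hee : IsIdempotentElem e) :
    (hS.nonzeroCorner e).IsGroup := by
  refine ⟨e, ⟨he0, hee, hee⟩, fun a ha => ha.2, fun a ⟨ha, hea, hae⟩ => ?_⟩
  obtain ⟨m, hm⟩ := hS.exists_mul_mul_eq_right (hae.symm ▸ ha)
  obtain ⟨z, hz⟩ := hS.exists_mul_mul_eq_left (hea.symm ▸ ha)
  rw [hae] at hm
  rw [hea] at hz
  have hright : a * (e * z * e) = e := by
    rw [← mul_assoc, ← mul_assoc, hae, hz, hee.eq]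
  have hleft : e * z * e * a = e :=
    calc e * z * e * a = m * (a * (e * z * e)) * a := by
          rw [← mul_assoc m, hm, ← mul_assoc, ← mul_assoc, hee.eq]
      _ = e := by rw [hright, mul_assoc, hea, hm]
  refine ⟨e * z * e, ⟨fun h => he0 ?_, ?_, ?_⟩, hright, hleft⟩
  · rw [← hright, h, mul_zero]
  · rw [← mul_assoc, ← mul_assoc, hee.eq]
  · rw [mul_assoc, hee.eq]

theorem exists_le_nonzeroCorner {T : Subsemigroup S} (hT : T.IsGroup) (hT0 : (T : Set S) ≠ {0}) :
    ∃ e, e ≠ 0 ∧ IsIdempotentElem e ∧ T ≤ hS.nonzeroCorner e := by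
  obtain ⟨e, heT, hone, hinv⟩ := hT
  have he0 : e ≠ 0 := by
    rintro rfl
    refine hT0 (Set.eq_singleton_iff_unique_mem.2 ⟨heT, fun x hx => ?_⟩)
    rw [← (hone x hx).1, zero_mul]
  refine ⟨e, he0, (hone e heT).1, fun x hx => ⟨?_, hone x hx⟩⟩
  rintro rfl
  obtain ⟨y, -, hy, -⟩ := hinv 0 hx
  exact he0 (by rw [← hy, zero_mul])

theorem eq_of_mem_nonzeroCorner {f : S} (he : IsIdempotentElem e)
    (hef : e ∈ hS.nonzeroCorner f) : f = e := by
  obtain ⟨he0, hfe, hef⟩ := hef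
  obtain ⟨m, hm⟩ := hS.exists_mul_mul_eq_right (hef.symm ▸ he0)
  rw [hef] at hm
  rw [← hfe, ← hm, mul_assoc, he.eq]

theorem isNonzeroMaximalSubgroup_nonzeroCorner (he0 : e ≠ 0) (hee : IsIdempotentElem e) :
    (hS.nonzeroCorner e).IsNonzeroMaximalSubgroup := by
  have he : e ∈ hS.nonzeroCorner e := ⟨he0, hee, hee⟩
  have hne {T : Subsemigroup S} (hT : e ∈ T) : (T : Set S) ≠ {0} := fun h => he0 (h.le hT)
  refine ⟨⟨hS.isGroup_nonzeroCorner he0 hee, fun T hT hle => ?_⟩, hne he⟩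
  obtain ⟨f, -, -, hTf⟩ := hS.exists_le_nonzeroCorner hT (hne (hle he))
  obtain rfl := hS.eq_of_mem_nonzeroCorner hee (hTf (hle he))
  exact hTf

theorem exists_eq_nonzeroCorner {T : Subsemigroup S} (hT : T.IsNonzeroMaximalSubgroup) :
    ∃ e, T = hS.nonzeroCorner e := by
  obtain ⟨⟨hgroup, hmax⟩, hne⟩ := hT
  obtain ⟨e, he0, hee, hle⟩ := hS.exists_le_nonzeroCorner hgroup hne
  exact ⟨e, hle.antisymm (hmax (hS.isGroup_nonzeroCorner he0 hee) hle)⟩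

end IsCompletelyZeroSimple

/-- The group structure on a subsemigroup that is a group; its multiplication is definitionally
the one inherited from `S`. -/
noncomputable abbrev groupOfIsGroup {S : Type*} [Semigroup S] {T : Subsemigroup S}
    (hT : T.IsGroup) : Group T :=
  { (inferInstance : Semigroup T) with
    one := ⟨hT.choose, hT.choose_spec.1⟩
    one_mul := fun x => Subtype.ext (hT.choose_spec.2.1 x x.2).1
    mul_one := fun x => Subtype.ext (hT.choose_spec.2.1 x x.2).2
    inv := fun x => ⟨(hT.choose_spec.2.2 x x.2).choose, (hT.choose_spec.2.2 x x.2).choose_spec.1⟩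
    inv_mul_cancel := fun x => Subtype.ext (hT.choose_spec.2.2 x x.2).choose_spec.2.2 }

/-- `ι` embeds the group `G` in `S` with image the non-zero elements of `eSe`, where `e = ι 1`. -/
structure IsCornerEmbedding {G : Type*} [Group G] (ι : G →ₙ* S) : Prop where
  injective : Function.Injective ι
  mem_range_iff : ∀ s, s ∈ Set.range ι ↔ s ≠ 0 ∧ ι 1 * s = s ∧ s * ι 1 = s

theorem IsCompletelyZeroSimple.isCornerEmbedding_subtype (hS : IsCompletelyZeroSimple S)
    {T : Subsemigroup S} (hT : T.IsNonzeroMaximalSubgroup) :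
    letI := groupOfIsGroup hT.1.1
    IsCornerEmbedding (MulMemClass.subtype T) := by
  obtain ⟨e, rfl⟩ := hS.exists_eq_nonzeroCorner hT
  let := groupOfIsGroup hT.1.1
  have hone : MulMemClass.subtype (hS.nonzeroCorner e) 1 = e :=
    hS.eq_of_mem_nonzeroCorner (congrArg Subtype.val (mul_one (1 : hS.nonzeroCorner e)))
      (1 : hS.nonzeroCorner e).2 |>.symm
  refine ⟨Subtype.val_injective, fun s => ?_⟩
  rw [hone]
  exact ⟨fun ⟨a, ha⟩ => ha ▸ a.2, fun hs => ⟨⟨s, hs⟩, rfl⟩⟩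

end CompletelyZeroSimple

section FiniteGeneration

theorem exists_generator_eq_or_eq_mul {S X : Type*} [Semigroup S] {σ : FreeSemigroup X →ₙ* S}
    (hσ : Function.Surjective σ) (s : S) :
    ∃ x, s = σ (FreeSemigroup.of x) ∨ ∃ u, s = u * σ (FreeSemigroup.of x) := by
  obtain ⟨t, rfl⟩ := hσ s
  induction t using FreeSemigroup.recOnMul with
  | ih1 x => exact ⟨x, Or.inl rfl⟩
  | ih2 x t _ ih =>
    obtain ⟨y, hy | ⟨u, hu⟩⟩ := ih
    · exact ⟨y, Or.inr ⟨_, by rw [map_mul, hy]⟩⟩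
    · exact ⟨y, Or.inr ⟨σ (FreeSemigroup.of x) * u, by rw [map_mul, hu, mul_assoc]⟩⟩

variable {S X : Type*} [SemigroupWithZero S] [Finite X] {σ : FreeSemigroup X →ₙ* S}

namespace IsCompletelyZeroSimple

variable (hS : IsCompletelyZeroSimple S) (hσ : Function.Surjective σ)

include hS hσ

theorem finite_range_of_le_mul {α : Type*} [PartialOrder α] {f : S → α}
    (hf : ∀ m s, f s ≤ f (m * s)) : (Set.range f).Finite := by
  refine ((Set.finite_range fun x => f (σ (FreeSemigroup.of x))).insert (f 0)).subset ?_
  rintro _ ⟨s, rfl⟩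
  rcases eq_or_ne s 0 with rfl | hs
  · exact Set.mem_insert _ _
  obtain ⟨x, rfl | ⟨u, rfl⟩⟩ := exists_generator_eq_or_eq_mul hσ s
  · exact Set.mem_insert_of_mem _ ⟨x, rfl⟩
  · obtain ⟨m, hm⟩ := hS.exists_mul_mul_eq_right hs
    exact Set.mem_insert_of_mem _ ⟨x, (hf u _).antisymm ((hf m _).trans_eq (congrArg f hm))⟩

theorem isRegular_pathLanguage_zero {B : Type*} {step : S → B → S → Prop}
    (hstep : ∀ m s b t, step s b t → step (m * s) b (m * t)) (s : S) :
    (pathLanguage step s 0).IsRegular :=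
  isRegular_pathLanguage_of_finite_range <| hS.finite_range_of_le_mul hσ fun m s w hw =>
    show LabelledPath step (m * s) w 0 by
      simpa only [mul_zero] using LabelledPath.map (hstep m) hw

end IsCompletelyZeroSimple

end FiniteGeneration

section RightIdeal

variable {S : Type*} [SemigroupWithZero S]

/-- The non-zero elements of the right ideal `eS`, for an idempotent `e`. -/
abbrev NonzeroRightIdeal (e : S) : Type _ := {v : S // v ≠ 0 ∧ e * v = v}

/-- The graph induced by `mulStep c` on the non-zero elements of `eS`. -/
abbrev rightIdealStep {X : Type*} (c : X → S) (e : S) :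
    NonzeroRightIdeal e → X ⊕ X → NonzeroRightIdeal e → Prop :=
  restrictStep (mulStep c) fun v => v ≠ 0 ∧ e * v = v

theorem exists_labelledPath_rightIdealStep {e : S} {v v' : NonzeroRightIdeal e}
    {X : Type*} {σ : FreeSemigroup X →ₙ* S} {t : FreeSemigroup X} (h : v.1 * σ t = v') :
    ∃ w, LabelledPath (rightIdealStep (σ ∘ FreeSemigroup.of) e) v w v' := by
  induction t using FreeSemigroup.recOnMul generalizing v with
  | ih1 x => exact ⟨[Sum.inl x], v', h, rfl⟩
  | ih2 x t _ ht =>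
    rw [map_mul, ← mul_assoc] at h
    let u : NonzeroRightIdeal e := ⟨v.1 * σ (FreeSemigroup.of x),
      left_ne_zero_of_mul (h.trans_ne v'.2.1), by rw [← mul_assoc, v.2.2]⟩
    obtain ⟨w, hw⟩ := ht (v := u) h
    exact ⟨Sum.inl x :: w, u, rfl, hw⟩

namespace IsCompletelyZeroSimple

variable (hS : IsCompletelyZeroSimple S) {e a : S} (ha : a ≠ 0 ∧ a * e = a)

/-- Left multiplication by a non-zero element of `Se`. -/
def mulNonzeroRightIdeal (v : NonzeroRightIdeal e) : {s : S // s ≠ 0} :=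
  ⟨a * v, hS.mul_ne_zero ha.1 ha.2 v.2.1 v.2.2⟩

theorem mulNonzeroRightIdeal_injective : Function.Injective (hS.mulNonzeroRightIdeal ha) :=
  fun v v' h =>
    Subtype.ext (hS.mul_left_cancel ha.1 ha.2 v.2.2 v'.2.2 (congrArg Subtype.val h))

variable {X : Type*} {c : X → S}

theorem exists_rightIdealStep {v : NonzeroRightIdeal e} {b : X ⊕ X} {t : {s : S // s ≠ 0}}
    (h : restrictStep (mulStep c) (· ≠ 0) (hS.mulNonzeroRightIdeal ha v) b t) :
    ∃ u, hS.mulNonzeroRightIdeal ha u = t ∧ rightIdealStep c e v b u := by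
  obtain ⟨t, ht⟩ := t
  cases b with
  | inl x =>
    obtain rfl : a * v.1 * c x = t := h
    rw [mul_assoc] at ht
    exact ⟨⟨v.1 * c x, right_ne_zero_of_mul ht, by rw [← mul_assoc, v.2.2]⟩,
      Subtype.ext (mul_assoc _ _ _).symm, rfl⟩
  | inr x =>
    have htx : t * c x = a * v.1 := h
    obtain ⟨z, hz⟩ := hS.exists_mul_mul_eq_left
      (htx.trans_ne (hS.mulNonzeroRightIdeal ha v).2)
    have hav : a * (v.1 * z) = t := by rw [← mul_assoc, ← htx, hz]
    have hvz : e * (v.1 * z) = v.1 * z := by rw [← mul_assoc, v.2.2]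
    have hvzx : e * (v.1 * z * c x) = v.1 * z * c x := by rw [← mul_assoc, hvz]
    exact ⟨⟨v.1 * z, right_ne_zero_of_mul (hav ▸ ht), hvz⟩, Subtype.ext hav,
      hS.mul_left_cancel ha.1 ha.2 hvzx v.2.2 (by rw [← mul_assoc, hav, htx])⟩

theorem pathLanguage_mulNonzeroRightIdeal (v v' : NonzeroRightIdeal e) :
    pathLanguage (restrictStep (mulStep c) (· ≠ 0)) (hS.mulNonzeroRightIdeal ha v)
      (hS.mulNonzeroRightIdeal ha v') = pathLanguage (rightIdealStep c e) v v' := by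
  ext w
  refine ⟨fun h => ?_, LabelledPath.map fun _ _ _ => mulStep.mul_left a⟩
  obtain ⟨u, hu, h⟩ := LabelledPath.exists_of_map (fun _ _ _ => hS.exists_rightIdealStep ha) h
  exact hS.mulNonzeroRightIdeal_injective ha hu ▸ h

theorem pathLanguage_eq_zero_of_notMem_range {v : NonzeroRightIdeal e} {t : {s : S // s ≠ 0}}
    (ht : t ∉ Set.range (hS.mulNonzeroRightIdeal ha)) :
    pathLanguage (restrictStep (mulStep c) (· ≠ 0)) (hS.mulNonzeroRightIdeal ha v) t = 0 := by
  refine Set.eq_empty_of_forall_notMem fun w h => ht ?_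
  obtain ⟨u, hu, -⟩ := LabelledPath.exists_of_map (fun _ _ _ => hS.exists_rightIdealStep ha) h
  exact ⟨u, hu⟩

end IsCompletelyZeroSimple

end RightIdeal

namespace IsCornerEmbedding

variable {S G : Type*} [SemigroupWithZero S] [Group G] {ι : G →ₙ* S}
  (hι : IsCornerEmbedding ι)

include hι

theorem map_ne_zero (g : G) : ι g ≠ 0 :=
  ((hι.mem_range_iff _).1 ⟨g, rfl⟩).1

theorem exists_map_mul_eq {v r : NonzeroRightIdeal (ι 1)} {n : S} (h : n * r = v.1) :
    ∃ g, ι g * r = v := by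
  have hnr : ι 1 * n * ι 1 * r = v := by
    rw [mul_assoc, r.2.2, mul_assoc, h, v.2.2]
  obtain ⟨g, hg⟩ := (hι.mem_range_iff (ι 1 * n * ι 1)).2
    ⟨fun h0 => v.2.1 (by rw [← hnr, h0, zero_mul]),
      by rw [← mul_assoc, ← mul_assoc, ← map_mul, mul_one],
      by rw [mul_assoc, ← map_mul, mul_one]⟩
  exact ⟨g, by rw [hg, hnr]⟩

variable (hS : IsCompletelyZeroSimple S)

/-- The group `G` acts by left multiplication on the non-zero elements of `eS`, where `e = ι 1`. -/
abbrev mulAction : MulAction G (NonzeroRightIdeal (ι 1)) where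
  smul g v := ⟨ι g * v, hS.mul_ne_zero (hι.map_ne_zero g) (by rw [← map_mul, mul_one]) v.2.1 v.2.2,
    by rw [← mul_assoc, ← map_mul, one_mul]⟩
  one_smul v := Subtype.ext v.2.2
  mul_smul g h v := Subtype.ext ((congrArg (· * v.1) (map_mul ι g h)).trans (mul_assoc _ _ _))

include hS

theorem map_mul_right_cancel {g g' : G} {v : S} (hv : v ≠ 0) (hev : ι 1 * v = v)
    (h : ι g * v = ι g' * v) : g = g' :=
  hι.injective <| hS.mul_right_cancel hv hev (by rw [← map_mul, mul_one])
    (by rw [← map_mul, mul_one]) h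

theorem exists_finite_forall_eq_mul {X : Type*} [Finite X] {σ : FreeSemigroup X →ₙ* S}
    (hσ : Function.Surjective σ) : ∃ s : Set (NonzeroRightIdeal (ι 1)), s.Finite ∧
      ∀ v : NonzeroRightIdeal (ι 1), ∃ g, ∃ r ∈ s, ι g * r = v := by
  have hone : IsIdempotentElem (ι 1) := IsIdempotentElem.one.map ι
  have hfactor (x : {x // σ (FreeSemigroup.of x) ≠ 0}) :
      ∃ (a : S) (r : NonzeroRightIdeal (ι 1)), a * r = σ (FreeSemigroup.of x.1) := by
    obtain ⟨a, r, -, hr, h⟩ := hS.exists_eq_mul (hι.map_ne_zero 1) hone x.2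
    exact ⟨a, ⟨r, hr⟩, h⟩
  choose a r har using hfactor
  refine ⟨Set.range r, Set.finite_range r, fun v => ?_⟩
  obtain ⟨x, u, hv⟩ : ∃ x u, v.1 = u * σ (FreeSemigroup.of x) := by
    obtain ⟨x, hv | ⟨u, hv⟩⟩ := exists_generator_eq_or_eq_mul hσ v.1
    · exact ⟨x, ι 1, by rw [← hv, v.2.2]⟩
    · exact ⟨x, u, hv⟩
  have hx : σ (FreeSemigroup.of x) ≠ 0 := right_ne_zero_of_mul (hv ▸ v.2.1)
  obtain ⟨g, hg⟩ := hι.exists_map_mul_eq (r := r ⟨x, hx⟩) (n := u * a ⟨x, hx⟩)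
    (by rw [mul_assoc, har, hv])
  exact ⟨g, _, ⟨_, rfl⟩, hg⟩

variable {X : Type} [Finite X] {σ : FreeSemigroup X →ₙ* S}

theorem isProperCocompact_rightIdealStep (hσ : Function.Surjective σ) :
    letI := hι.mulAction hS
    IsProperCocompact G (rightIdealStep (σ ∘ FreeSemigroup.of) (ι 1)) := by
  let := hι.mulAction hS
  refine ⟨fun g _ _ _ => mulStep.mul_left (ι g), fun v u => ?_, fun v b u => ?_, ?_⟩
  · refine Set.Subsingleton.finite fun g hg g' hg' => ?_
    exact hι.map_mul_right_cancel hS u.2.1 u.2.2 (congrArg Subtype.val (hg.symm.trans hg'))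
  · refine Set.Subsingleton.finite fun g hg g' hg' => ?_
    cases b with
    | inl x => exact hι.map_mul_right_cancel hS u.2.1 u.2.2 (hg.symm.trans hg')
    | inr x =>
      have hmul {k : G}
          (hk : rightIdealStep (σ ∘ FreeSemigroup.of) (ι 1) v (Sum.inr x) (k • u)) :
          ι k * (u.1 * σ (FreeSemigroup.of x)) = v :=
        (mul_assoc _ _ _).symm.trans hk
      exact hι.map_mul_right_cancel hS (right_ne_zero_of_mul ((hmul hg).trans_ne v.2.1))
        (by rw [← mul_assoc, u.2.2]) ((hmul hg).trans (hmul hg').symm)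
  · obtain ⟨s, hs, h⟩ := hι.exists_finite_forall_eq_mul hS hσ
    refine ⟨s, hs, fun v => ?_⟩
    obtain ⟨g, r, hr, hv⟩ := h v
    exact ⟨g, r, hr, Subtype.ext hv.symm⟩

theorem isFinGenSemigroup (hfg : IsFinGenSemigroup S) : IsFinGenSemigroup G := by
  obtain ⟨X, _, σ, hσ⟩ := hfg
  let := hι.mulAction hS
  refine (hι.isProperCocompact_rightIdealStep hS hσ).isFinGenSemigroup
    ⟨ι 1, hι.map_ne_zero 1, by rw [← map_mul, mul_one]⟩ fun g => ?_
  obtain ⟨t, ht⟩ := hσ (ι g)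
  have hmul : ι 1 * σ t = ι g * ι 1 := by rw [ht, ← map_mul, ← map_mul, one_mul, mul_one]
  exact exists_labelledPath_rightIdealStep hmul

variable {F : LanguageFamily} (hT : F.ClosedUnderTransduction) (hG : HasLoopProblemIn F G)

include hT hG

theorem pathLanguage_ne_zero_mem (hσ : Function.Surjective σ) (s t : {s : S // s ≠ 0}) :
    pathLanguage (restrictStep (mulStep (σ ∘ FreeSemigroup.of)) (· ≠ 0)) s t ∈ F (X ⊕ X) := by
  obtain ⟨a, v, ha, hv, hav⟩ := hS.exists_eq_mul (hι.map_ne_zero 1) (IsIdempotentElem.one.map ι) s.2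
  obtain rfl : hS.mulNonzeroRightIdeal ha ⟨v, hv⟩ = s := Subtype.ext hav
  by_cases ht : t ∈ Set.range (hS.mulNonzeroRightIdeal ha)
  · obtain ⟨v', rfl⟩ := ht
    let := hι.mulAction hS
    rw [hS.pathLanguage_mulNonzeroRightIdeal]
    exact (hι.isProperCocompact_rightIdealStep hS hσ).pathLanguage_mem hT hG _ v'
  · rw [hS.pathLanguage_eq_zero_of_notMem_range ha ht]
    exact hG.containsRegular hT _ _ isRegular_zero

theorem pathLanguage_mem (hU : F.ClosedUnderUnion) (hP : F.ClosedUnderProduct)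
    (hσ : Function.Surjective σ) (s t : S) :
    pathLanguage (mulStep (σ ∘ FreeSemigroup.of)) s t ∈ F (X ⊕ X) := by
  have hto0 (s : S) : pathLanguage (mulStep (σ ∘ FreeSemigroup.of)) s 0 ∈ F (X ⊕ X) :=
    hG.containsRegular hT _ _ <|
      hS.isRegular_pathLanguage_zero hσ (fun m _ _ _ => mulStep.mul_left m) s
  have hfrom0 (t : S) : pathLanguage (mulStep (σ ∘ FreeSemigroup.of)) 0 t ∈ F (X ⊕ X) := by
    rw [pathLanguage_eq_reverse]
    exact hG.containsRegular hT _ _ <| Language.IsRegular.reverse <|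
      hS.isRegular_pathLanguage_zero hσ (fun m _ _ _ => mulStep.mul_left m) t
  rcases eq_or_ne s 0 with rfl | hs
  · exact hfrom0 t
  rcases eq_or_ne t 0 with rfl | ht
  · exact hto0 s
  rw [pathLanguage_eq_add_mul hs ht]
  exact hU _ _ _ (hι.pathLanguage_ne_zero_mem hS hT hG hσ ⟨s, hs⟩ ⟨t, ht⟩)
    (hP _ _ _ (hto0 s) (hfrom0 t))

theorem hasLoopProblemIn (hU : F.ClosedUnderUnion) (hP : F.ClosedUnderProduct)
    (hK : F.ClosedUnderKleene) (hfg : IsFinGenSemigroup S) : HasLoopProblemIn F S := by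
  obtain ⟨X, _, σ, hσ⟩ := hfg
  exact ⟨X, ‹_›, σ, hσ, loopProblem_mem_of_pathLanguage_mem hU hP hK (hG.containsRegular hT) σ
    (hι.pathLanguage_mem hS hT hG hU hP hσ)⟩

end IsCornerEmbedding

theorem mainTheorem2 (F : LanguageFamily)
    (hUnion : F.ClosedUnderUnion) (hTransduction : F.ClosedUnderTransduction)
    (hProduct : F.ClosedUnderProduct) (hKleene : F.ClosedUnderKleene)
    {S : Type*} [SemigroupWithZero S] (hfg : IsFinGenSemigroup S)
    (hS : IsCompletelyZeroSimple S) :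
    List.TFAE [
      HasLoopProblemIn F S,
      ∃ T : Subsemigroup S, T.IsNonzeroMaximalSubgroup ∧ HasLoopProblemIn F T,
      ∀ T : Subsemigroup S, T.IsNonzeroMaximalSubgroup → HasLoopProblemIn F T] := by
  tfae_have 1 → 3 := by
    intro h T hT
    let := groupOfIsGroup hT.1.1
    have hι := hS.isCornerEmbedding_subtype hT
    exact h.of_injective hTransduction hι.injective (hι.isFinGenSemigroup hS hfg)
  tfae_have 3 → 2 := by
    intro h
    obtain ⟨e, he0, hee, -⟩ := hS.2
    have hT := hS.isNonzeroMaximalSubgroup_nonzeroCorner he0 hee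
    exact ⟨_, hT, h _ hT⟩
  tfae_have 2 → 1 := by
    rintro ⟨T, hT, h⟩
    let := groupOfIsGroup hT.1.1
    exact (hS.isCornerEmbedding_subtype hT).hasLoopProblemIn hS hTransduction h hUnion hProduct
      hKleene hfg
  tfae_finish
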